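/- Let $G$ be a finitely generated torsion-free nilpotent group, and let $\overline{G}$ be its rational closure (Malcev completion): the torsion-free nilpotent group, unique up to isomorphism over $G$, that contains $G$, in which every element has a unique $n$-th root for every positive integer $n$, and every element of which has a positive power in $G$. A subgroup $K\le\overline{G}$ is called rational if $h\in\overline{G}$, $n\geq 1$ and $h^n\in K$ imply $h\in K$; a rational subgroup is rationally indecomposable if it is not the (internal) direct product of two nontrivial rational subgroups. For a subgroup $K\le G$ let $\overline{K}\le\overline{G}$ denote its rational closure, that is, the smallest rational subgroup of $\overline{G}$ containing $K$. Suppose that $\overline{G}=S_1\times S_2\times\cdots\times S_m$ is an internal direct decomposition of $\overline{G}$ into nontrivial rational subgroups, each of which is rationally indecomposable, and that $G=G_1\times G_2$ is an internal direct decomposition of $G$ with $G_1\neq 1$ and $G_2\neq 1$. Then the $S_i$ can be reordered and an index $j$ with $1\le j<m$ can be chosen such that, with $R_1=S_1\times\cdots\times S_j$ and $R_2=S_{j+1}\times\cdots\times S_m$ (so that $\overline{G}=R_1\times R_2$), the decomposition $\overline{G}=R_1\times R_2$ matches the decomposition $G=G_1\times G_2$, i.e. $$\overline{G_i}\,Z(\overline{G})=R_i\,Z(\overline{G})\qquad\text{for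 } i=1,2,$$ where $Z(\overline{G})$ is the center of $\overline{G}$. -/

import Mathlib

open scoped Pointwise

/-- A group is torsion-free if the identity is its only element of finite order. -/
def GroupTorsionFree (G : Type*) [Group G] : Prop :=
  ∀ g : G, IsOfFinOrder g → g = 1

/-- `ι : G →* H` exhibits `H` as the rational closure (Malcev completion) of `G`:
`H` is a torsion-free nilpotent group, `G` embeds in `H`, every element of `H` has a unique
`n`-th root for each `n > 0`, and every element of `H` has a positive power in `G`. -/
structure IsRationalClosure {G H : Type*} [Group G] [Group H] (ι : G →* H) : Prop where
  nilpotent : Group.IsNilpotent H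
  torsionFree : GroupTorsionFree H
  injective : Function.Injective ι
  existsUnique_root : ∀ (h : H) (n : ℕ), 0 < n → ∃! k : H, k ^ n = h
  exists_pow_mem : ∀ h : H, ∃ n : ℕ, 0 < n ∧ h ^ n ∈ ι.range

/-- A subgroup is rational if it is closed under taking roots. -/
def IsRationalSubgroup {H : Type*} [Group H] (K : Subgroup H) : Prop :=
  ∀ (h : H) (n : ℕ), 0 < n → h ^ n ∈ K → h ∈ K

/-- The rational closure, inside `H`, of a subgroup `K` of `H`: the smallest rational subgroup of
`H` that contains `K`. See `rationalClosureIn_eq_of_roots` for the comparison with the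
characterization by roots and powers. -/
def rationalClosureIn {H : Type*} [Group H] (K : Subgroup H) : Subgroup H :=
  sInf {C : Subgroup H | IsRationalSubgroup C ∧ K ≤ C}

/-- A rational subgroup containing `K` all of whose elements have a positive power in `K` is the
rational closure of `K`. -/
theorem rationalClosureIn_eq_of_roots {H : Type*} [Group H] {K C : Subgroup H}
    (hC : IsRationalSubgroup C) (hKC : K ≤ C)
    (hpow : ∀ h ∈ C, ∃ n : ℕ, 0 < n ∧ h ^ n ∈ K) : rationalClosureIn K = C := by
  apply le_antisymm
  · exact sInf_le ⟨hC, hKC⟩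
  · refine le_sInf ?_
    rintro D ⟨hD, hKD⟩ h hh
    obtain ⟨n, hn, hm⟩ := hpow h hh
    exact hD h n hn (hKD hm)

/-- The subgroup `K` is the internal direct product `A × B`. -/
structure IsDirectProduct {H : Type*} [Group H] (A B K : Subgroup H) : Prop where
  commute : ∀ a ∈ A, ∀ b ∈ B, a * b = b * a
  disjoint : A ⊓ B = ⊥
  sup_eq : A ⊔ B = K

/-- The subgroup `K` is the internal direct product of the family `S`. -/
structure IsDirectProductFamily {H : Type*} [Group H] {I : Type*} (S : I → Subgroup H)
    (K : Subgroup H) : Prop where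
  commute : ∀ i j : I, i ≠ j → ∀ a ∈ S i, ∀ b ∈ S j, a * b = b * a
  indep : iSupIndep S
  iSup_eq : ⨆ i, S i = K

/-- A subgroup is rationally indecomposable if it is not the direct product of two nontrivial
rational subgroups. -/
def RationallyIndecomposable {H : Type*} [Group H] (K : Subgroup H) : Prop :=
  ∀ A B : Subgroup H, IsRationalSubgroup A → IsRationalSubgroup B → IsDirectProduct A B K →
    A = ⊥ ∨ B = ⊥

/-- The decomposition `H = R₁ × R₂` of a rational closure `ι : G →* H` matches the decomposition
`G = G₁ × G₂`: the subgroups `rationalClosure(Gᵢ) · Z(H)` and `Rᵢ · Z(H)` coincide, `i = 1, 2`. -/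
def DecompositionMatches {G H : Type*} [Group G] [Group H] (ι : G →* H)
    (R₁ R₂ : Subgroup H) (G₁ G₂ : Subgroup G) : Prop :=
  (rationalClosureIn (G₁.map ι) : Set H) * (Subgroup.center H : Set H) =
      (R₁ : Set H) * (Subgroup.center H : Set H) ∧
    (rationalClosureIn (G₂.map ι) : Set H) * (Subgroup.center H : Set H) =
      (R₂ : Set H) * (Subgroup.center H : Set H)

/-! Let `A` and `B` be the rational closures of `G₁` and `G₂`, and let `Z` be the center of `H`.
Unique roots carry commutation and trivial intersection from `G` to `H`, so `H = A × B`. What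
follows is a Krull–Schmidt argument up to the center.

Take one factor `S` of `H`. Restrict the projections onto `A` and `B` to `S` and project back to
`S`: this gives two normal endomorphisms of `S` with pointwise product the identity. As `S` is
indecomposable, Fitting's lemma (`RationallyIndecomposable.surjective_or_surjective`) makes one of
them surjective. The finiteness it needs comes from a rank of Hirsch-length type on `G`, which
bounds chains of rational subgroups. If the map through `A` is surjective, then `S ≤ AZ`, because
the projection to `A` sends `S` into the centralizer of its complement
(`le_sup_center_of_surjective`). So each `S i` lies in `AZ` or in `BZ`. Grouping the factors
accordingly gives `R₁` and `R₂`, and the inclusions become equalities since `AZ ∩ BZ = Z`.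

Both groups must be nonempty. If all `S i` lie in `BZ`, then `H = BZ` and `A` is central. A
nontrivial homomorphism `G₁ → ℤ` then splits a rank one central factor off some `S i`, which by
indecomposability is all of `S i`. Such an `S i` lies in both `AZ` and `BZ`, so it may be put on
either side. -/

open scoped commutatorElement

/-! ### Powers and roots in nilpotent groups -/

/-- The central elements having a positive power in `K`. -/
def centralRoots {M : Type*} [Group M] (K : Subgroup M) : Subgroup M where
  carrier := {x | x ∈ Subgroup.center M ∧ ∃ k : ℕ, 0 < k ∧ x ^ k ∈ K}
  one_mem' := ⟨one_mem _, 1, one_pos, by simp⟩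
  mul_mem' := by
    rintro x y ⟨hx, k, hk, hxk⟩ ⟨hy, l, hl, hyl⟩
    refine ⟨mul_mem hx hy, k * l, by positivity, ?_⟩
    have hc : Commute x y := (Subgroup.mem_center_iff.mp hy x)
    rw [hc.mul_pow, pow_mul, mul_comm k l, pow_mul]
    exact mul_mem (pow_mem hxk _) (pow_mem hyl _)
  inv_mem' := by
    rintro x ⟨hx, k, hk, hxk⟩
    exact ⟨inv_mem hx, k, hk, by rw [inv_pow]; exact inv_mem hxk⟩

theorem commutatorElement_pow_right {M : Type*} [Group M] {x y : M}
    (h : ⁅x, y⁆ ∈ Subgroup.center M) (m : ℕ) : ⁅x, y ^ m⁆ = ⁅x, y⁆ ^ m := by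
  have hc : Commute ⁅x, y⁆ y := ((Subgroup.mem_center_iff.mp h) y).symm
  have h1 : x * y * x⁻¹ = ⁅x, y⁆ * y := by simp [commutatorElement_def]
  rw [commutatorElement_def, ← conj_pow, h1, hc.mul_pow]
  simp

theorem commutatorElement_pow_left {M : Type*} [Group M] {x y : M}
    (h : ⁅x, y⁆ ∈ Subgroup.center M) (m : ℕ) : ⁅x ^ m, y⁆ = ⁅x, y⁆ ^ m := by
  have h' : ⁅y, x⁆ ∈ Subgroup.center M := by
    rw [← commutatorElement_inv]; exact inv_mem h
  rw [← commutatorElement_inv, commutatorElement_pow_right h', ← inv_pow, commutatorElement_inv]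

theorem commutatorElement_mul_center {M : Type*} [Group M] {z z' : M}
    (hz : z ∈ Subgroup.center M) (hz' : z' ∈ Subgroup.center M) (y y' : M) :
    ⁅y * z, y' * z'⁆ = ⁅y, y'⁆ := by
  have h1 : ∀ g, z * g * z⁻¹ = g := fun g => by
    rw [← Subgroup.mem_center_iff.mp hz g, mul_inv_cancel_right]
  have h2 : ∀ g, z' * g * z'⁻¹ = g := fun g => by
    rw [← Subgroup.mem_center_iff.mp hz' g, mul_inv_cancel_right]
  calc ⁅y * z, y' * z'⁆
      = y * (z * (y' * z') * z⁻¹) * y⁻¹ * z'⁻¹ * y'⁻¹ := by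
        rw [commutatorElement_def]; group
    _ = y * y' * (z' * y⁻¹ * z'⁻¹) * y'⁻¹ := by rw [h1]; group
    _ = ⁅y, y'⁆ := by rw [h2, commutatorElement_def]

theorem lowerCentralSeries_le_center {M : Type*} [Group M] {n : ℕ}
    (h : (⊤ : Subgroup M).lowerCentralSeries (n + 1) = ⊥) :
    (⊤ : Subgroup M).lowerCentralSeries n ≤ Subgroup.center M := by
  intro x hx
  rw [Subgroup.mem_center_iff]
  intro y
  have : ⁅x, y⁆ ∈ (⊤ : Subgroup M).lowerCentralSeries (n + 1) :=
    Subgroup.commutator_mem_commutator hx (Subgroup.mem_top y)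
  rw [h, Subgroup.mem_bot, commutatorElement_eq_one_iff_mul_comm] at this
  exact this.symm

theorem lowerCentralSeries_quotient {M : Type*} [Group M] (N : Subgroup M) [N.Normal] (n : ℕ) :
    (⊤ : Subgroup (M ⧸ N)).lowerCentralSeries n =
      ((⊤ : Subgroup M).lowerCentralSeries n).map (QuotientGroup.mk' N) := by
  rw [Subgroup.map_lowerCentralSeries,
    Subgroup.map_top_of_surjective _ (QuotientGroup.mk'_surjective N)]

theorem lowerCentralSeries_quotient_self {M : Type*} [Group M] (n : ℕ) :
    (⊤ : Subgroup (M ⧸ (⊤ : Subgroup M).lowerCentralSeries n)).lowerCentralSeries n = ⊥ := by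
  rw [lowerCentralSeries_quotient, Subgroup.map_eq_bot_iff, QuotientGroup.ker_mk']

theorem exists_mul_eq_of_mk_mem_map {M : Type*} [Group M] {N K : Subgroup M} [N.Normal] {x : M}
    (h : QuotientGroup.mk' N x ∈ K.map (QuotientGroup.mk' N)) :
    ∃ y ∈ K, ∃ z ∈ N, y * z = x := by
  obtain ⟨y, hy, hyx⟩ := h
  exact ⟨y, hy, y⁻¹ * x, QuotientGroup.eq.mp hyx, by simp⟩

/-- In a nilpotent group generated by elements having a positive power in `K`, every element has
a positive power in `K`. -/
theorem exists_pow_mem_of_closure_eq_top (n : ℕ) :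
    ∀ {M : Type*} [Group M], (⊤ : Subgroup M).lowerCentralSeries n = ⊥ →
      ∀ (K : Subgroup M) (X : Set M), Subgroup.closure X = ⊤ →
        (∀ x ∈ X, ∃ k : ℕ, 0 < k ∧ x ^ k ∈ K) → ∀ x : M, ∃ k : ℕ, 0 < k ∧ x ^ k ∈ K := by
  induction n with
  | zero =>
    intro M _ h K X _ _ x
    have hx : x ∈ (⊤ : Subgroup M).lowerCentralSeries 0 := Subgroup.mem_top x
    rw [h, Subgroup.mem_bot] at hx
    exact ⟨1, one_pos, by simp [hx]⟩
  | succ n ih =>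
    intro M _ h K X hX hXK x
    have hNc := lowerCentralSeries_le_center h
    set N := (⊤ : Subgroup M).lowerCentralSeries n with hN
    have hquot : ∀ x : M, ∃ k : ℕ, 0 < k ∧ ∃ y ∈ K, ∃ z ∈ N, y * z = x ^ k := by
      intro x
      have := ih (M := M ⧸ N) (lowerCentralSeries_quotient_self n) (K.map (QuotientGroup.mk' N))
        (QuotientGroup.mk' N '' X)
        (by rw [← MonoidHom.map_closure, hX,
          Subgroup.map_top_of_surjective _ (QuotientGroup.mk'_surjective N)])
        (by
          rintro _ ⟨y, hy, rfl⟩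
          obtain ⟨k, hk, hyk⟩ := hXK y hy
          exact ⟨k, hk, by rw [← map_pow]; exact Subgroup.mem_map_of_mem _ hyk⟩)
        (QuotientGroup.mk' N x)
      obtain ⟨k, hk, hxk⟩ := this
      rw [← map_pow] at hxk
      exact ⟨k, hk, exists_mul_eq_of_mk_mem_map hxk⟩
    -- `N` is central and, for positive index, generated by commutators. These are multiplicative in
    -- each slot, so `⁅a, b⁆ ^ (k * l) = ⁅a ^ k, b ^ l⁆`, which depends only on `a ^ k` and `b ^ l`
    -- modulo `N`. At index zero `N` is the whole group, which is then abelian.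
    have hNK : N ≤ centralRoots K := by
      cases n with
      | zero =>
        have hle : (⊤ : Subgroup M) ≤ Subgroup.center M := hNc
        change (⊤ : Subgroup M) ≤ _
        rw [← hX, Subgroup.closure_le]
        exact fun y hy => ⟨hle (Subgroup.mem_top y), hXK y hy⟩
      | succ n =>
        rw [hN, Subgroup.lowerCentralSeries_succ, Subgroup.commutator_le]
        intro a ha b _
        have hc : ⁅a, b⁆ ∈ Subgroup.center M :=
          hNc (Subgroup.commutator_mem_commutator ha (Subgroup.mem_top b))
        refine ⟨hc, ?_⟩
        obtain ⟨k, hk, y, hy, z, hz, hyz⟩ := hquot a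
        obtain ⟨l, hl, y', hy', z', hz', hyz'⟩ := hquot b
        refine ⟨k * l, by positivity, ?_⟩
        have hck : ⁅a ^ k, b⁆ ∈ Subgroup.center M := by
          rw [commutatorElement_pow_left hc]; exact pow_mem hc k
        have h1 : ⁅a, b⁆ ^ (k * l) = ⁅y, y'⁆ := by
          rw [pow_mul, ← commutatorElement_pow_left hc, ← commutatorElement_pow_right hck,
            ← hyz, ← hyz']
          exact commutatorElement_mul_center (hNc hz) (hNc hz') y y'
        rw [h1, commutatorElement_def]
        exact mul_mem (mul_mem (mul_mem hy hy') (inv_mem hy)) (inv_mem hy')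
    obtain ⟨k, hk, y, hy, z, hz, hyz⟩ := hquot x
    obtain ⟨l, hl, hzl⟩ := (hNK hz).2
    refine ⟨k * l, by positivity, ?_⟩
    have hc : Commute y z := Subgroup.mem_center_iff.mp (hNc hz) y
    rw [pow_mul, ← hyz, hc.mul_pow]
    exact mul_mem (pow_mem hy l) hzl

/-! ### Finite generation and rank functions -/

/-- In a finitely generated group, each term of the lower central series is finitely generated
modulo the next one. -/
theorem exists_finite_lowerCentralSeries_le (G : Type*) [Group G] [Group.FG G] (n : ℕ) :
    ∃ T : Set G, T.Finite ∧ T ⊆ (⊤ : Subgroup G).lowerCentralSeries n ∧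
      (⊤ : Subgroup G).lowerCentralSeries n ≤
        Subgroup.closure T ⊔ (⊤ : Subgroup G).lowerCentralSeries (n + 1) := by
  obtain ⟨X, hX, hXfin⟩ := (Group.fg_iff (G := G)).mp inferInstance
  induction n with
  | zero =>
    exact ⟨X, hXfin, fun _ _ => Subgroup.mem_top _, by rw [hX]; exact le_sup_of_le_left le_top⟩
  | succ n ih =>
    obtain ⟨T, hT, hTn, hle⟩ := ih
    refine ⟨Set.image2 (fun a b => ⁅a, b⁆) T X, hT.image2 _ hXfin, ?_, ?_⟩
    · rintro _ ⟨a, ha, b, hb, rfl⟩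
      exact Subgroup.commutator_mem_commutator (hTn ha) (Subgroup.mem_top b)
    set M := Subgroup.closure (Set.image2 (fun a b => ⁅a, b⁆) T X) ⊔
      (⊤ : Subgroup G).lowerCentralSeries (n + 1 + 1) with hM
    have hMle : M ≤ (⊤ : Subgroup G).lowerCentralSeries (n + 1) := by
      refine sup_le ?_ (Subgroup.lowerCentralSeries_antitone _ (Nat.le_succ _))
      rw [Subgroup.closure_le]
      rintro _ ⟨a, ha, b, hb, rfl⟩
      exact Subgroup.commutator_mem_commutator (hTn ha) (Subgroup.mem_top b)
    have hMcomm : ∀ x ∈ (⊤ : Subgroup G).lowerCentralSeries (n + 1), ∀ g : G, ⁅x, g⁆ ∈ M :=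
      fun x hx g => (le_sup_right : _ ≤ M)
        (Subgroup.commutator_mem_commutator hx (Subgroup.mem_top g))
    have hMn : M.Normal := by
      refine ⟨fun x hx g => ?_⟩
      have h1 := hMcomm x (hMle hx) g
      have h2 : g * x * g⁻¹ = ⁅x, g⁆⁻¹ * x := by
        rw [commutatorElement_def]; group
      rw [h2]
      exact mul_mem (inv_mem h1) hx
    -- Modulo `M` the generators `T` commute with the generators `X` of `G`, so the `n`-th term
    -- becomes central and its commutators with `G` fall into `M`.
    have hcent : (⊤ : Subgroup G).lowerCentralSeries n ≤
        (Subgroup.center (G ⧸ M)).comap (QuotientGroup.mk' M) := by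
      refine hle.trans (sup_le ?_ ?_)
      · rw [Subgroup.closure_le]
        intro a ha
        have hXc : (⊤ : Subgroup G) ≤
            (Subgroup.centralizer {QuotientGroup.mk' M a}).comap (QuotientGroup.mk' M) := by
          rw [← hX, Subgroup.closure_le]
          intro b hb
          change QuotientGroup.mk' M b ∈ Subgroup.centralizer _
          rw [Subgroup.mem_centralizer_singleton_iff, eq_comm,
            ← commutatorElement_eq_one_iff_mul_comm, ← map_commutatorElement]
          exact (QuotientGroup.eq_one_iff _).mpr ((le_sup_left : _ ≤ M)
            (Subgroup.subset_closure ⟨a, ha, b, hb, rfl⟩))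
        change QuotientGroup.mk' M a ∈ Subgroup.center _
        rw [Subgroup.mem_center_iff]
        intro g
        obtain ⟨g, rfl⟩ := QuotientGroup.mk'_surjective M g
        exact Subgroup.mem_centralizer_singleton_iff.mp (hXc (Subgroup.mem_top g))
      · intro x hx
        change QuotientGroup.mk' M x ∈ Subgroup.center _
        rw [Subgroup.mem_center_iff]
        intro g
        obtain ⟨g, rfl⟩ := QuotientGroup.mk'_surjective M g
        rw [eq_comm, ← commutatorElement_eq_one_iff_mul_comm, ← map_commutatorElement]
        exact (QuotientGroup.eq_one_iff _).mpr (hMcomm x hx g)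
    rw [Subgroup.lowerCentralSeries_succ, Subgroup.commutator_le]
    intro a ha b _
    have := Subgroup.mem_center_iff.mp (hcent ha) (QuotientGroup.mk' M b)
    rw [eq_comm] at this
    erw [← commutatorElement_eq_one_iff_mul_comm, ← map_commutatorElement] at this
    exact (QuotientGroup.eq_one_iff _).mp this

theorem lowerCentralSeries_fg {G : Type*} [Group G] [Group.FG G] {n : ℕ}
    (h : (⊤ : Subgroup G).lowerCentralSeries (n + 1) = ⊥) :
    Group.FG ((⊤ : Subgroup G).lowerCentralSeries n) := by
  obtain ⟨T, hT, hTn, hle⟩ := exists_finite_lowerCentralSeries_le G n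
  rw [h, sup_bot_eq] at hle
  rw [Group.fg_iff_subgroup_fg, Subgroup.fg_iff]
  exact ⟨T, le_antisymm ((Subgroup.closure_le _).mpr hTn) hle, hT⟩

/-- `r` is monotone, and nested subgroups of equal `r` agree up to taking powers. -/
structure IsRankFunction {G : Type*} [Group G] (r : Subgroup G → ℕ) : Prop where
  monotone : Monotone r
  exists_pow_mem : ∀ {K L : Subgroup G}, K ≤ L → r K = r L →
    ∀ x ∈ L, ∃ k : ℕ, 0 < k ∧ x ^ k ∈ K

/-- Take the `ℤ`-rank: if `K ≤ L` have equal rank, the quotient `L / K` has rank zero and is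
torsion. -/
theorem exists_isRankFunction_of_commGroup (G : Type*) [CommGroup G] [Group.FG G] :
    ∃ r : Subgroup G → ℕ, IsRankFunction r := by
  have : Module.Finite ℤ (Additive G) := Module.Finite.iff_addGroup_fg.mpr inferInstance
  let s : Subgroup G → Submodule ℤ (Additive G) := fun K =>
    AddSubgroup.toIntSubmodule (Subgroup.toAddSubgroup K)
  have hs : Monotone s := fun K L h x hx => h hx
  refine ⟨fun K => Module.finrank ℤ (s K), fun K L h => Submodule.finrank_mono (hs h), ?_⟩
  intro K L hKL hr x hx
  have hle := hs hKL
  have h1 := Submodule.finrank_quotient_add_finrank ((s K).submoduleOf (s L))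
  rw [(Submodule.submoduleOfEquivOfLe hle).finrank_eq] at h1
  have h0 : Module.finrank ℤ (s L ⧸ (s K).submoduleOf (s L)) = 0 := by
    have : Module.finrank ℤ (s K) = Module.finrank ℤ (s L) := hr
    omega
  rw [Module.finrank_eq_zero_iff_isTorsion] at h0
  obtain ⟨a, ha⟩ := h0 (x := Submodule.Quotient.mk (⟨Additive.ofMul x, hx⟩ : s L))
  rw [Submonoid.smul_def, ← Submodule.Quotient.mk_smul, Submodule.Quotient.mk_eq_zero] at ha
  have ha' : x ^ (a : ℤ) ∈ K := ha
  have ha0 : (a : ℤ) ≠ 0 := nonZeroDivisors.ne_zero a.2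
  refine ⟨(a : ℤ).natAbs, Int.natAbs_pos.mpr ha0, ?_⟩
  rcases Int.natAbs_eq (a : ℤ) with h | h
  · rw [h, zpow_natCast] at ha'; exact ha'
  · rw [h, zpow_neg, zpow_natCast] at ha'; exact inv_mem_iff.mp ha'

theorem exists_isRankFunction_of_mul_comm (G : Type*) [Group G] [Group.FG G]
    (h : ∀ x y : G, x * y = y * x) : ∃ r : Subgroup G → ℕ, IsRankFunction r :=
  @exists_isRankFunction_of_commGroup G { ‹Group G› with mul_comm := h } ‹_›

/-- Ranks add along the central extension by the term `N` of index `n`: use the rank of `K ∩ N` plus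
that of the image of `K` in `G / N`. Both are monotone, so equality of the sums forces equality of
each. -/
theorem exists_isRankFunction_of_lowerCentralSeries (n : ℕ) :
    ∀ {G : Type*} [Group G] [Group.FG G], (⊤ : Subgroup G).lowerCentralSeries n = ⊥ →
      ∃ r : Subgroup G → ℕ, IsRankFunction r := by
  induction n with
  | zero =>
    intro G _ _ h
    refine ⟨fun _ => 0, fun _ _ _ => le_rfl, fun {K L} _ _ x _ => ⟨1, one_pos, ?_⟩⟩
    have hx : x ∈ (⊤ : Subgroup G).lowerCentralSeries 0 := Subgroup.mem_top x
    rw [h, Subgroup.mem_bot] at hx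
    simp [hx]
  | succ n ih =>
    intro G _ _ h
    have hNc := lowerCentralSeries_le_center h
    have hNfg := lowerCentralSeries_fg h
    have hq := ih (lowerCentralSeries_quotient_self (M := G) n)
    set N := (⊤ : Subgroup G).lowerCentralSeries n
    obtain ⟨r₁, h₁⟩ := exists_isRankFunction_of_mul_comm N
      fun x y => Subtype.ext (Subgroup.mem_center_iff.mp (hNc y.2) x)
    obtain ⟨r₂, h₂⟩ := hq
    have m₁ : Monotone fun K : Subgroup G => r₁ (K.subgroupOf N) :=
      fun K L hKL => h₁.monotone (Subgroup.comap_mono hKL)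
    have m₂ : Monotone fun K : Subgroup G => r₂ (K.map (QuotientGroup.mk' N)) :=
      fun K L hKL => h₂.monotone (Subgroup.map_mono hKL)
    refine ⟨fun K => r₁ (K.subgroupOf N) + r₂ (K.map (QuotientGroup.mk' N)),
      fun K L hKL => add_le_add (m₁ hKL) (m₂ hKL), ?_⟩
    intro K L hKL hr x hx
    have l₁ := m₁ hKL
    have l₂ := m₂ hKL
    simp only at l₁ l₂ hr
    obtain ⟨k, hk, hxk⟩ := h₂.exists_pow_mem (Subgroup.map_mono hKL) (by omega)
      (QuotientGroup.mk' N x) (Subgroup.mem_map_of_mem _ hx)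
    rw [← map_pow] at hxk
    obtain ⟨y, hy, z, hz, hyz⟩ := exists_mul_eq_of_mk_mem_map hxk
    have hzL : z ∈ L := by
      have : z = y⁻¹ * x ^ k := by rw [← hyz]; group
      rw [this]
      exact mul_mem (inv_mem (hKL hy)) (pow_mem hx k)
    obtain ⟨l, hl, hzl⟩ := h₁.exists_pow_mem (Subgroup.comap_mono hKL) (by
      change r₁ (K.subgroupOf N) = r₁ (L.subgroupOf N); omega) ⟨z, hz⟩
      (Subgroup.mem_subgroupOf.mpr hzL)
    refine ⟨k * l, by positivity, ?_⟩
    have hc : Commute y z := Subgroup.mem_center_iff.mp (hNc hz) y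
    rw [pow_mul, ← hyz, hc.mul_pow]
    exact mul_mem (pow_mem hy l) hzl

/-! ### Internal direct products and the center -/

section DirectProducts

variable {H : Type*} [Group H]

theorem IsDirectProduct.symm {A B K : Subgroup H} (h : IsDirectProduct A B K) :
    IsDirectProduct B A K :=
  ⟨fun b hb a ha => (h.commute a ha b hb).symm, by rw [inf_comm, h.disjoint],
    by rw [sup_comm, h.sup_eq]⟩

theorem IsDirectProduct.map {T : Type*} [Group T] {A B K : Subgroup T}
    (h : IsDirectProduct A B K) {f : T →* H} (hf : Function.Injective f) :
    IsDirectProduct (A.map f) (B.map f) (K.map f) := by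
  refine ⟨?_, ?_, ?_⟩
  · rintro _ ⟨a, ha, rfl⟩ _ ⟨b, hb, rfl⟩
    rw [← map_mul, h.commute a ha b hb, map_mul]
  · rw [← Subgroup.map_inf _ _ _ hf, h.disjoint, Subgroup.map_bot]
  · rw [← Subgroup.map_sup, h.sup_eq]

/-- `α` and `β` are the projections of the group onto its direct factors `A` and `B`. -/
structure AreProjections (A B : Subgroup H) (α β : H →* H) : Prop where
  left_mem : ∀ x, α x ∈ A
  right_mem : ∀ x, β x ∈ B
  mul_eq : ∀ x, α x * β x = x
  left_apply : ∀ a ∈ A, α a = a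

theorem IsDirectProduct.exists_projections {A B : Subgroup H} (h : IsDirectProduct A B ⊤) :
    ∃ α β : H →* H, AreProjections A B α β := by
  have hc : ∀ (a : A) (b : B), Commute (A.subtype a) (B.subtype b) :=
    fun a b => h.commute a a.2 b b.2
  let φ : A × B →* H := A.subtype.noncommCoprod B.subtype hc
  have hφ : ∀ p : A × B, φ p = p.1 * p.2 := fun p => rfl
  have hinj : Function.Injective φ := by
    rw [injective_iff_map_eq_one]
    rintro ⟨a, b⟩ hab
    rw [hφ] at hab
    have hab' : (a : H) = (b : H)⁻¹ := eq_inv_of_mul_eq_one_left hab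
    have ha : (a : H) ∈ A ⊓ B :=
      Subgroup.mem_inf.mpr ⟨a.2, by rw [hab']; exact inv_mem b.2⟩
    rw [h.disjoint, Subgroup.mem_bot] at ha
    rw [ha, one_mul] at hab
    exact Prod.ext (Subtype.ext ha) (Subtype.ext hab)
  have hsurj : Function.Surjective φ := by
    have : (⊤ : Subgroup H) ≤ φ.range := by
      rw [← h.sup_eq]
      refine sup_le (fun a ha => ⟨(⟨a, ha⟩, 1), by simp [hφ]⟩)
        (fun b hb => ⟨(1, ⟨b, hb⟩), by simp [hφ]⟩)
    exact fun x => this (Subgroup.mem_top x)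
  let e : A × B ≃* H := MulEquiv.ofBijective φ ⟨hinj, hsurj⟩
  have he : ∀ p : A × B, e p = p.1 * p.2 := fun p => rfl
  have hl : ∀ a (ha : a ∈ A), e.symm a = (⟨a, ha⟩, 1) := fun a ha => by
    rw [MulEquiv.symm_apply_eq, he]; simp
  refine ⟨(A.subtype.comp (MonoidHom.fst A B)).comp e.symm.toMonoidHom,
    (B.subtype.comp (MonoidHom.snd A B)).comp e.symm.toMonoidHom,
    fun x => (e.symm x).1.2, fun x => (e.symm x).2.2, fun x => ?_, fun a ha => ?_⟩
  · exact (he (e.symm x)).symm.trans (e.apply_symm_apply x)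
  · exact congrArg (fun p : A × B => (p.1 : H)) (hl a ha)

/-- Projections are normal endomorphisms: the `B`-component of `t` acts trivially on `α s`. -/
theorem AreProjections.left_conj {A B : Subgroup H} {α β : H →* H} (hp : AreProjections A B α β)
    (h : IsDirectProduct A B ⊤) (t s : H) : α (t * s * t⁻¹) = t * α s * t⁻¹ := by
  have h1 : Commute (α s) (β t) := h.commute _ (hp.left_mem s) _ (hp.right_mem t)
  rw [map_mul, map_mul, map_inv]
  conv_rhs => rw [← hp.mul_eq t]
  rw [mul_inv_rev, mul_assoc (α t) (β t), ← h1.eq]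
  group

theorem AreProjections.right_conj {A B : Subgroup H} {α β : H →* H} (hp : AreProjections A B α β)
    (h : IsDirectProduct A B ⊤) (t s : H) : β (t * s * t⁻¹) = t * β s * t⁻¹ := by
  have h1 : Commute (α t) (β s) := h.commute _ (hp.left_mem t) _ (hp.right_mem s)
  have h2 : Commute (α t) (β t) := h.commute _ (hp.left_mem t) _ (hp.right_mem t)
  rw [map_mul, map_mul, map_inv]
  conv_rhs => rw [← hp.mul_eq t]
  rw [h2.eq, mul_inv_rev, mul_assoc (β t) (α t), h1.eq]
  group

theorem mem_center_of_commute_factors {A B : Subgroup H} (h : IsDirectProduct A B ⊤) {x : H}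
    (hA : ∀ a ∈ A, a * x = x * a) (hB : ∀ b ∈ B, b * x = x * b) : x ∈ Subgroup.center H := by
  have : (⊤ : Subgroup H) ≤ Subgroup.centralizer {x} := by
    rw [← h.sup_eq]
    exact sup_le (fun a ha => Subgroup.mem_centralizer_singleton_iff.mpr (hA a ha))
      (fun b hb => Subgroup.mem_centralizer_singleton_iff.mpr (hB b hb))
  exact Subgroup.mem_center_iff.mpr fun g =>
    Subgroup.mem_centralizer_singleton_iff.mp (this (Subgroup.mem_top g))

/-- `A` times the center centralizes `B`, and `B` times the center centralizes `A`; an element of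
both centralizes `A` and `B`. -/
theorem IsDirectProduct.sup_center_inf_sup_center_le {A B : Subgroup H}
    (h : IsDirectProduct A B ⊤) :
    (A ⊔ Subgroup.center H) ⊓ (B ⊔ Subgroup.center H) ≤ Subgroup.center H := by
  have key : ∀ {A B : Subgroup H}, IsDirectProduct A B ⊤ → ∀ x ∈ A ⊔ Subgroup.center H,
      ∀ b ∈ B, b * x = x * b := by
    intro A B h x hx b hb
    have : A ⊔ Subgroup.center H ≤ Subgroup.centralizer {b} :=
      sup_le (fun a ha => Subgroup.mem_centralizer_singleton_iff.mpr (h.commute a ha b hb))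
        (fun z hz => Subgroup.mem_centralizer_singleton_iff.mpr
          (Subgroup.mem_center_iff.mp hz b).symm)
    exact (Subgroup.mem_centralizer_singleton_iff.mp (this hx)).symm
  exact fun x hx => mem_center_of_commute_factors h (key h.symm x hx.2) (key h x hx.1)

/-- The `R₂`-component of an element of `A` lies in both `A ⊔ Subgroup.center H` and `B ⊔
Subgroup.center H`, so it is central. -/
theorem IsDirectProduct.sup_center_eq {A B R₁ R₂ : Subgroup H} (h : IsDirectProduct A B ⊤)
    (hR : IsDirectProduct R₁ R₂ ⊤) (h₁ : R₁ ≤ A ⊔ Subgroup.center H)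
    (h₂ : R₂ ≤ B ⊔ Subgroup.center H) : A ⊔ Subgroup.center H = R₁ ⊔ Subgroup.center H := by
  refine le_antisymm (sup_le ?_ le_sup_right) (sup_le h₁ le_sup_right)
  intro a ha
  obtain ⟨α, β, hp⟩ := hR.exists_projections
  have hβ : β a = (α a)⁻¹ * a := by rw [eq_inv_mul_iff_mul_eq, hp.mul_eq]
  have hβZ : β a ∈ Subgroup.center H := h.sup_center_inf_sup_center_le <| Subgroup.mem_inf.mpr
    ⟨by rw [hβ]; exact mul_mem (inv_mem (h₁ (hp.left_mem a))) (Subgroup.mem_sup_left ha),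
      h₂ (hp.right_mem a)⟩
  rw [← hp.mul_eq a]
  exact mul_mem (Subgroup.mem_sup_left (hp.left_mem a)) (Subgroup.mem_sup_right hβZ)

theorem IsDirectProductFamily.exists_mulEquiv {I : Type*} [Fintype I] [DecidableEq I]
    {S : I → Subgroup H} (h : IsDirectProductFamily S ⊤) :
    ∃ e : (∀ i, S i) ≃* H, ∀ i (y : S i), e (Pi.mulSingle i y) = y := by
  have hc : Pairwise fun i j : I => ∀ x y : H, x ∈ S i → y ∈ S j → Commute x y :=
    fun i j hij x y hx hy => h.commute i j hij x hx y hy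
  have hinj := Subgroup.injective_noncommPiCoprod_of_iSupIndep h.indep (hcomm := hc)
  have hsurj : Function.Surjective (Subgroup.noncommPiCoprod hc) := by
    rw [← MonoidHom.range_eq_top, Subgroup.noncommPiCoprod_range, h.iSup_eq]
  exact ⟨MulEquiv.ofBijective _ ⟨hinj, hsurj⟩,
    fun i y => Subgroup.noncommPiCoprod_mulSingle (hcomm := hc) i y⟩

theorem IsDirectProductFamily.isDirectProduct_biSup {I : Type*} [Fintype I]
    {S : I → Subgroup H} (h : IsDirectProductFamily S ⊤) (J : Set I) :
    IsDirectProduct (⨆ i ∈ J, S i) (⨆ i ∈ Jᶜ, S i) ⊤ := by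
  classical
  obtain ⟨e, he⟩ := h.exists_mulEquiv
  refine ⟨?_, ?_, ?_⟩
  · have h1 : ∀ j ∈ Jᶜ, ∀ b ∈ S j, (⨆ i ∈ J, S i) ≤ Subgroup.centralizer {b} := by
      intro j hj b hb
      refine iSup₂_le fun i hi a ha => Subgroup.mem_centralizer_singleton_iff.mpr ?_
      exact h.commute i j (fun hij => hj (hij ▸ hi)) a ha b hb
    intro a ha b hb
    have h2 : (⨆ i ∈ Jᶜ, S i) ≤ Subgroup.centralizer {a} := by
      refine iSup₂_le fun j hj b hb => Subgroup.mem_centralizer_singleton_iff.mpr ?_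
      exact (Subgroup.mem_centralizer_singleton_iff.mp (h1 j hj b hb ha)).symm
    exact (Subgroup.mem_centralizer_singleton_iff.mp (h2 hb)).symm
  · have key : ∀ J : Set I, ∀ x ∈ ⨆ i ∈ J, S i, ∀ j ∉ J, e.symm x j = 1 := by
      intro J x hx j hj
      have : (⨆ i ∈ J, S i) ≤
          ((Pi.evalMonoidHom (fun i => S i) j).comp e.symm.toMonoidHom).ker := by
        refine iSup₂_le fun i hi y hy => ?_
        change e.symm y j = 1
        have hij : j ≠ i := fun hij => hj (hij ▸ hi)
        have hey : e.symm y = Pi.mulSingle i ⟨y, hy⟩ := by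
          rw [MulEquiv.symm_apply_eq, he]
        rw [hey, Pi.mulSingle_eq_of_ne hij]
      exact this hx
    rw [eq_bot_iff]
    rintro x ⟨hx1, hx2⟩
    have : e.symm x = 1 := by
      funext j
      by_cases hj : j ∈ J
      · exact key _ x hx2 j (fun h => h hj)
      · exact key _ x hx1 j hj
    rw [Subgroup.mem_bot]
    simpa using this
  · rw [eq_top_iff, ← h.iSup_eq]
    refine iSup_le fun i => ?_
    by_cases hi : i ∈ J
    · exact le_sup_of_le_left (le_biSup S hi)
    · exact le_sup_of_le_right (le_biSup S (show i ∈ Jᶜ from hi))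

/-- The components of a central element are central, and if all of them lay in `D`, so would their
product. -/
theorem IsDirectProductFamily.exists_central_component {I : Type*} [Fintype I]
    {S : I → Subgroup H} (h : IsDirectProductFamily S ⊤) {D : Subgroup H} {z : H}
    (hz : z ∈ Subgroup.center H) (hzD : z ∉ D) :
    ∃ i, ∃ x ∈ S i, x ∈ Subgroup.center H ∧ x ∉ D := by
  classical
  obtain ⟨e, he⟩ := h.exists_mulEquiv
  by_contra hcon
  push Not at hcon
  apply hzD
  set f := e.symm z with hf
  have hmem : f ∈ D.comap e.toMonoidHom := by
    refine Subgroup.pi_mem_of_mulSingle_mem _ fun i => ?_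
    change e (Pi.mulSingle i (f i)) ∈ D
    rw [he]
    refine hcon i _ (f i).2 (Subgroup.mem_center_iff.mpr fun g => ?_)
    rw [← he, ← e.apply_symm_apply g, ← map_mul, ← map_mul]
    congr 1
    have hcomm : e.symm g * f = f * e.symm g := by
      rw [hf, ← map_mul, ← map_mul, Subgroup.mem_center_iff.mp hz]
    funext j
    by_cases hij : j = i
    · subst hij
      simpa using congrFun hcomm j
    · simp [Pi.mulSingle_eq_of_ne hij]
  have := Subgroup.mem_comap.mp hmem
  change e f ∈ D at this
  rwa [hf, e.apply_symm_apply] at this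

end DirectProducts

/-! ### Rational subgroups and their chains -/

section Rational

variable {H : Type*} [Group H]

theorem IsRationalSubgroup.mem_of_zpow_mem {K : Subgroup H} (hK : IsRationalSubgroup K) {h : H}
    {n : ℤ} (hn : n ≠ 0) (hh : h ^ n ∈ K) : h ∈ K := by
  refine hK h n.natAbs (Int.natAbs_pos.mpr hn) ?_
  rcases Int.natAbs_eq n with h' | h'
  · rw [h', zpow_natCast] at hh; exact hh
  · rw [h', zpow_neg, zpow_natCast] at hh; exact inv_mem_iff.mp hh

theorem isRationalSubgroup_inf {K L : Subgroup H} (hK : IsRationalSubgroup K)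
    (hL : IsRationalSubgroup L) : IsRationalSubgroup (K ⊓ L) :=
  fun h n hn hh => ⟨hK h n hn hh.1, hL h n hn hh.2⟩

theorem isRationalSubgroup_ker [IsMulTorsionFree H] {T : Type*} [Group T] (f : T →* H) :
    IsRationalSubgroup f.ker := by
  intro h n hn hh
  rw [MonoidHom.mem_ker, map_pow] at hh
  exact (pow_eq_one_iff_left hn.ne').mp hh

theorem isRationalSubgroup_range [IsMulTorsionFree H] {T : Type*} [Group T]
    (hd : ∀ (h : T) (n : ℕ), 0 < n → ∃ k, k ^ n = h) (f : T →* H) :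
    IsRationalSubgroup f.range := by
  rintro h n hn ⟨t, ht⟩
  obtain ⟨k, rfl⟩ := hd t n hn
  rw [map_pow] at ht
  exact ⟨k, pow_left_injective hn.ne' ht⟩

/-- `x` and its conjugate by `y` have the same `n`-th power, hence coincide. -/
theorem mul_comm_of_pow_mul_comm [IsMulTorsionFree H] {x y : H} {n : ℕ} (hn : n ≠ 0)
    (h : x ^ n * y = y * x ^ n) : x * y = y * x := by
  have h1 : (y * x * y⁻¹) ^ n = x ^ n := by
    rw [conj_pow, ← h, mul_inv_cancel_right]
  have h2 : y * x * y⁻¹ = x := pow_left_injective hn h1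
  rw [mul_inv_eq_iff_eq_mul] at h2
  exact h2.symm

theorem isRationalSubgroup_center [IsMulTorsionFree H] :
    IsRationalSubgroup (Subgroup.center H) := by
  intro h n hn hh
  rw [Subgroup.mem_center_iff] at hh ⊢
  exact fun g => (mul_comm_of_pow_mul_comm hn.ne' (hh g).symm).symm

theorem isRationalSubgroup_map_subtype {S : Subgroup H} (hS : IsRationalSubgroup S)
    {K : Subgroup S} (hK : IsRationalSubgroup K) : IsRationalSubgroup (K.map S.subtype) := by
  rintro h n hn ⟨k, hk, hkh⟩
  have hhS : h ∈ S := hS h n hn (by rw [← hkh]; exact k.2)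
  refine ⟨⟨h, hhS⟩, hK _ n hn ?_, rfl⟩
  have : (⟨h, hhS⟩ : S) ^ n = k := Subtype.ext hkh.symm
  rw [this]; exact hk

theorem RationallyIndecomposable.top_subtype {S : Subgroup H} (hS : IsRationalSubgroup S)
    (h : RationallyIndecomposable S) : RationallyIndecomposable (⊤ : Subgroup S) := by
  intro A B hA hB hAB
  have h1 := hAB.map S.subtype_injective
  rw [← MonoidHom.range_eq_map, Subgroup.range_subtype] at h1
  have h2 := h _ _ (isRationalSubgroup_map_subtype hS hA) (isRationalSubgroup_map_subtype hS hB) h1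
  simpa [Subgroup.map_eq_bot_iff_of_injective _ S.subtype_injective] using h2

/-- In a nilpotent group, every element of the rational closure of `K` has a positive power
in `K`. -/
theorem isRational_rationalClosureIn_and_exists_pow_mem (hnil : Group.IsNilpotent H)
    (K : Subgroup H) : IsRationalSubgroup (rationalClosureIn K) ∧ K ≤ rationalClosureIn K ∧
      ∀ h ∈ rationalClosureIn K, ∃ n : ℕ, 0 < n ∧ h ^ n ∈ K := by
  let X : Set H := {h | ∃ n : ℕ, 0 < n ∧ h ^ n ∈ K}
  have hKC : K ≤ Subgroup.closure X := fun k hk =>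
    Subgroup.subset_closure ⟨1, one_pos, by rwa [pow_one]⟩
  have hpow : ∀ h ∈ Subgroup.closure X, ∃ n : ℕ, 0 < n ∧ h ^ n ∈ K := by
    intro h hh
    obtain ⟨c, hc⟩ := Subgroup.nilpotent_iff_lowerCentralSeries.mp
      (inferInstance : Group.IsNilpotent (Subgroup.closure X))
    exact exists_pow_mem_of_closure_eq_top c hc (K.subgroupOf (Subgroup.closure X)) _
      Subgroup.closure_closure_coe_preimage (fun x hx => hx) ⟨h, hh⟩
  have hrat : IsRationalSubgroup (Subgroup.closure X) := by
    intro h n hn hh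
    obtain ⟨m, hm, hhm⟩ := hpow _ hh
    exact Subgroup.subset_closure ⟨n * m, by positivity, by rwa [pow_mul]⟩
  rw [rationalClosureIn_eq_of_roots hrat hKC hpow]
  exact ⟨hrat, hKC, hpow⟩

theorem rationalClosureIn_le {K C : Subgroup H} (hC : IsRationalSubgroup C) (h : K ≤ C) :
    rationalClosureIn K ≤ C := sInf_le ⟨hC, h⟩

/-- Strictly increasing chains of rational subgroups have bounded length. -/
def RationalChainCondition (H : Type*) [Group H] : Prop :=
  ∃ ρ : Subgroup H → ℕ, Monotone ρ ∧
    ∀ K L : Subgroup H, K ≤ L → ρ K = ρ L → IsRationalSubgroup K → K = L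

/-- Pull subgroups back to `G` and take their rank there. Equal rank puts a power of each element of
`L` into `K`, and rationality of `K` removes the power. -/
theorem IsRationalClosure.rationalChainCondition {G : Type*} [Group G] [Group.FG G]
    (hnil : Group.IsNilpotent G) {ι : G →* H} (hι : IsRationalClosure ι) :
    RationalChainCondition H := by
  obtain ⟨c, hc⟩ := Subgroup.nilpotent_iff_lowerCentralSeries.mp hnil
  obtain ⟨r, hr⟩ := exists_isRankFunction_of_lowerCentralSeries c hc
  refine ⟨fun K => r (K.comap ι), fun K L h => hr.monotone (Subgroup.comap_mono h), ?_⟩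
  intro K L hKL h hK
  refine le_antisymm hKL fun x hx => ?_
  obtain ⟨n, hn, g, hg⟩ := hι.exists_pow_mem x
  obtain ⟨k, hk, hgk⟩ := hr.exists_pow_mem (Subgroup.comap_mono hKL) h g
    (by rw [Subgroup.mem_comap, hg]; exact pow_mem hx n)
  rw [Subgroup.mem_comap, map_pow, hg] at hgk
  exact hK _ n hn (hK _ k hk hgk)

theorem RationalChainCondition.subgroup (h : RationalChainCondition H) {S : Subgroup H}
    (hS : IsRationalSubgroup S) : RationalChainCondition S := by
  obtain ⟨ρ, hρ, hs⟩ := h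
  refine ⟨fun K => ρ (K.map S.subtype), fun K L h => hρ (Subgroup.map_mono h), ?_⟩
  intro K L hKL h hK
  exact Subgroup.map_injective S.subtype_injective
    (hs _ _ (Subgroup.map_mono hKL) h (isRationalSubgroup_map_subtype hS hK))

end Rational

/-! ### Fitting's lemma for normal endomorphisms -/

section Fitting

variable {T : Type*} [Group T]

/-- The iterates of an endomorphism. -/
def iterateHom (u : T →* T) : ℕ → (T →* T)
  | 0 => MonoidHom.id T
  | n + 1 => u.comp (iterateHom u n)

theorem iterateHom_add (u : T →* T) (m n : ℕ) (x : T) :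
    iterateHom u (m + n) x = iterateHom u m (iterateHom u n x) := by
  induction m with
  | zero => rw [Nat.zero_add]; rfl
  | succ m ih => rw [Nat.add_right_comm]; exact congrArg u ih

theorem iterateHom_conj {u : T →* T} (hu : ∀ t s, u (t * s * t⁻¹) = t * u s * t⁻¹) (n : ℕ)
    (t s : T) : iterateHom u n (t * s * t⁻¹) = t * iterateHom u n s * t⁻¹ := by
  induction n with
  | zero => rfl
  | succ n ih => exact (congrArg u ih).trans (hu _ _)

/-- Normality of `w` makes its range a normal subgroup, so the range and the kernel commute once
they meet trivially. -/
theorem isDirectProduct_ker_range {w : T →* T} (hw : ∀ t s, w (t * s * t⁻¹) = t * w s * t⁻¹)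
    (hker : (w.comp w).ker ≤ w.ker) (hrange : w.range ≤ (w.comp w).range) :
    IsDirectProduct w.ker w.range ⊤ := by
  have hdisj : w.ker ⊓ w.range = ⊥ := by
    rw [eq_bot_iff]
    rintro _ ⟨hx, t, rfl⟩
    exact hker (show w (w t) = 1 from hx)
  refine ⟨?_, hdisj, ?_⟩
  · have hn : w.range.Normal := by
      refine ⟨?_⟩
      rintro _ ⟨s, rfl⟩ g
      exact ⟨g * s * g⁻¹, hw g s⟩
    exact fun a ha b hb => Subgroup.commute_of_normal_of_disjoint _ _ inferInstance hn
      (disjoint_iff.mpr hdisj) a b ha hb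
  · rw [eq_top_iff]
    intro s _
    obtain ⟨t, ht⟩ := hrange ⟨s, rfl⟩
    have ht' : w (w t) = w s := ht
    have : s = (s * (w t)⁻¹) * w t := by group
    rw [this]
    refine mul_mem (Subgroup.mem_sup_left ?_) (Subgroup.mem_sup_right ⟨t, rfl⟩)
    rw [MonoidHom.mem_ker, map_mul, map_inv, ht', mul_inv_cancel]

/-- Fitting's lemma for two normal endomorphisms of an indecomposable divisible group whose
pointwise product is the identity. -/
theorem RationallyIndecomposable.surjective_or_surjective [IsMulTorsionFree T]
    (hd : ∀ (h : T) (n : ℕ), 0 < n → ∃ k, k ^ n = h) (hcc : RationalChainCondition T)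
    (hind : RationallyIndecomposable (⊤ : Subgroup T)) {u v : T →* T}
    (hu : ∀ t s, u (t * s * t⁻¹) = t * u s * t⁻¹) (huv : ∀ s, u s * v s = s) :
    Function.Surjective u ∨ Function.Surjective v := by
  obtain ⟨ρ, hρ, hs⟩ := hcc
  let U := iterateHom u
  have hU1 : ∀ n x, U (n + 1) x = u (U n x) := fun n x => rfl
  have hUadd : ∀ m n x, U (m + n) x = U m (U n x) := iterateHom_add u
  have hkm : Monotone fun n => (U n).ker := monotone_nat_of_le_succ fun n x hx => by
    change U (n + 1) x = 1
    rw [hU1, MonoidHom.mem_ker.mp hx, map_one]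
  have hra : Antitone fun n => (U n).range := antitone_nat_of_succ_le fun n => by
    rintro _ ⟨x, rfl⟩
    exact ⟨u x, (hUadd n 1 x).symm.trans rfl⟩
  -- Neither summand can grow with `n`, as kernels increase and ranges decrease. From a minimum of
  -- the sum onwards, both ranks are therefore constant.
  let D : ℕ → ℕ := fun n => (ρ ⊤ - ρ (U n).ker) + ρ (U n).range
  obtain ⟨n, hn⟩ : ∃ n, ∀ m, D n ≤ D m := ⟨Function.argmin D, fun m => Function.argmin_le D m⟩
  have hstab : ∀ m, n ≤ m → ρ (U n).ker = ρ (U m).ker ∧ ρ (U m).range = ρ (U n).range := by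
    intro m hm
    have h1 := hn m
    have h2 := hρ (hkm hm)
    have h3 := hρ (hra hm)
    have h4 : ρ (U m).ker ≤ ρ ⊤ := hρ le_top
    simp only [D] at h1 h2 h3
    omega
  have h2n : n ≤ n + 1 + (n + 1) := by omega
  -- The exponent `n + 1` rather than `n` guarantees a factor `u`, so that surjectivity of the
  -- iterate yields that of `u`.
  have hker : (U (n + 1)).ker = (U (n + 1 + (n + 1))).ker :=
    hs _ _ (hkm (by omega)) ((hstab _ n.le_succ).1.symm.trans (hstab _ h2n).1)
      (isRationalSubgroup_ker _)
  have hrange : (U (n + 1 + (n + 1))).range = (U (n + 1)).range :=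
    hs _ _ (hra (by omega)) ((hstab _ h2n).2.trans (hstab _ n.le_succ).2.symm)
      (isRationalSubgroup_range hd _)
  have hcomp : U (n + 1 + (n + 1)) = (U (n + 1)).comp (U (n + 1)) :=
    MonoidHom.ext fun x => hUadd _ _ x
  rw [hcomp] at hker hrange
  have hdp := isDirectProduct_ker_range (iterateHom_conj hu (n + 1)) hker.ge hrange.ge
  rcases hind _ _ (isRationalSubgroup_ker _) (isRationalSubgroup_range hd _) hdp with h | h
  · left
    have htop := hdp.sup_eq
    rw [h, bot_sup_eq] at htop
    intro x
    obtain ⟨y, hy⟩ : x ∈ (U (n + 1)).range := by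
      have := Subgroup.mem_top x
      rwa [← htop] at this
    exact ⟨U n y, (hU1 n y).symm.trans hy⟩
  · right
    -- Telescope `huv`, applying it to `U k s` at each stage. Once an iterate of `u` is trivial, `s`
    -- itself is a value of `v`.
    have hk : ∀ k s, ∃ t, s = U k s * v t := by
      intro k s
      induction k with
      | zero => exact ⟨1, by rw [map_one, mul_one]; rfl⟩
      | succ k ih =>
        obtain ⟨t, ht⟩ := ih
        refine ⟨U k s * t, ?_⟩
        rw [hU1, map_mul, ← mul_assoc, huv]
        exact ht
    intro s
    obtain ⟨t, ht⟩ := hk (n + 1) s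
    have h1 : U (n + 1) s = 1 := by
      have : U (n + 1) s ∈ (U (n + 1)).range := ⟨s, rfl⟩
      exact Subgroup.mem_bot.mp (h ▸ this)
    rw [h1, one_mul] at ht
    exact ⟨t, ht.symm⟩

end Fitting

/-! ### Each indecomposable factor lies in one side modulo the center -/

section Exchange

variable {H : Type*} [Group H]

/-- For `x ∈ S`, normality of `α` makes `α x` commute with `S'`. Hence its `S'`-component commutes
with both `S` and `S'` and is central, so `π (α x)` differs from `α x ∈ A` by a central element. -/
theorem le_sup_center_of_surjective {A S S' : Subgroup H} {α π π' : H →* H}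
    (hαA : ∀ x, α x ∈ A) (hα : ∀ t s, α (t * s * t⁻¹) = t * α s * t⁻¹)
    (hS : IsDirectProduct S S' ⊤) (hπ : AreProjections S S' π π')
    (h : ∀ s ∈ S, ∃ x ∈ S, π (α x) = s) : S ≤ A ⊔ Subgroup.center H := by
  intro s hs
  obtain ⟨x, hx, rfl⟩ := h s hs
  have hc : π' (α x) = (π (α x))⁻¹ * α x := by rw [eq_inv_mul_iff_mul_eq, hπ.mul_eq]
  have hcZ : π' (α x) ∈ Subgroup.center H := by
    refine mem_center_of_commute_factors hS (fun t ht => hS.commute t ht _ (hπ.right_mem _)) ?_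
    intro t ht
    have h1 : Commute t (α x) := by
      have := hα t x
      rw [← hS.commute x hx t ht, mul_inv_cancel_right, eq_mul_inv_iff_mul_eq] at this
      exact this.symm
    have h2 : Commute t (π (α x)) := (hS.commute _ (hπ.left_mem _) t ht).symm
    rw [hc]
    exact (h2.inv_right.mul_right h1).eq
  have h3 : π (α x) = α x * (π' (α x))⁻¹ := by rw [eq_mul_inv_iff_mul_eq, hπ.mul_eq]
  rw [h3]
  exact mul_mem (Subgroup.mem_sup_left (hαA x)) (Subgroup.mem_sup_right (inv_mem hcZ))

theorem RationallyIndecomposable.le_sup_center_or_le_sup_center [IsMulTorsionFree H]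
    (hd : ∀ (h : H) (n : ℕ), 0 < n → ∃ k, k ^ n = h) (hcc : RationalChainCondition H)
    {A B S S' : Subgroup H} (hAB : IsDirectProduct A B ⊤) (hSS : IsDirectProduct S S' ⊤)
    (hS : IsRationalSubgroup S) (hind : RationallyIndecomposable S) :
    S ≤ A ⊔ Subgroup.center H ∨ S ≤ B ⊔ Subgroup.center H := by
  obtain ⟨α, β, hp⟩ := hAB.exists_projections
  obtain ⟨π, π', hπ⟩ := hSS.exists_projections
  let u : S →* S := ((π.comp α).comp S.subtype).codRestrict S fun x => hπ.left_mem _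
  let v : S →* S := ((π.comp β).comp S.subtype).codRestrict S fun x => hπ.left_mem _
  have hdS : ∀ (h : S) (n : ℕ), 0 < n → ∃ k, k ^ n = h := by
    intro h n hn
    obtain ⟨k, hk⟩ := hd h n hn
    exact ⟨⟨k, hS k n hn (by rw [hk]; exact h.2)⟩, Subtype.ext hk⟩
  have hu : ∀ t s, u (t * s * t⁻¹) = t * u s * t⁻¹ := by
    intro t s
    apply Subtype.ext
    change π (α (t * s * (t : H)⁻¹)) = t * π (α s) * (t : H)⁻¹
    rw [hp.left_conj hAB, hπ.left_conj hSS]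
  have huv : ∀ s, u s * v s = s := by
    intro s
    apply Subtype.ext
    change π (α s) * π (β s) = s
    rw [← map_mul, hp.mul_eq, hπ.left_apply _ s.2]
  rcases (hind.top_subtype hS).surjective_or_surjective hdS (hcc.subgroup hS) hu huv with h | h
  · left
    refine le_sup_center_of_surjective hp.left_mem (hp.left_conj hAB) hSS hπ fun s hs => ?_
    obtain ⟨x, hx⟩ := h ⟨s, hs⟩
    exact ⟨x, x.2, congrArg Subtype.val hx⟩
  · right
    refine le_sup_center_of_surjective hp.right_mem (hp.right_conj hAB) hSS hπ fun s hs => ?_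
    obtain ⟨x, hx⟩ := h ⟨s, hs⟩
    exact ⟨x, x.2, congrArg Subtype.val hx⟩

end Exchange

/-! ### Central factors and the distribution of the `S i` -/

section Main

variable {G H : Type*} [Group G] [Group H]

/-- A nontrivial finitely generated torsion-free abelian group has a nontrivial homomorphism
to `ℤ`. -/
theorem exists_hom_int_ne_one (N : Type*) [CommGroup N] [Group.FG N] [IsMulTorsionFree N]
    [Nontrivial N] : ∃ (f : N →* Multiplicative ℤ) (g : N), f g ≠ 1 := by
  have : Module.Finite ℤ (Additive N) := Module.Finite.iff_addGroup_fg.mpr inferInstance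
  obtain ⟨g, hg⟩ := exists_ne (0 : Additive N)
  by_contra! hcon
  refine hg ((Module.forall_dual_apply_eq_zero_iff ℤ g).mp fun f => ?_)
  exact hcon (AddMonoidHom.toMultiplicativeRight f.toAddMonoidHom) g.toMul

theorem exists_hom_int_ne_one_of_mul_comm (N : Type*) [Group N] [Group.FG N] [IsMulTorsionFree N]
    [Nontrivial N] (h : ∀ x y : N, x * y = y * x) :
    ∃ (f : N →* Multiplicative ℤ) (g : N), f g ≠ 1 :=
  @exists_hom_int_ne_one N { ‹Group N› with mul_comm := h } ‹_› ‹_› ‹_›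

theorem IsRationalClosure.isMulTorsionFree {ι : G →* H} (hι : IsRationalClosure ι) :
    IsMulTorsionFree H :=
  ⟨fun n hn x _ hxy => (hι.existsUnique_root (x ^ n) n (Nat.pos_of_ne_zero hn)).unique rfl hxy.symm⟩

/-- To generate `H`, split a power `x ^ n` lying in `G` and take `n`-th roots of the two parts;
these roots commute, so their product is `x`. -/
theorem IsRationalClosure.isDirectProduct {ι : G →* H} (hι : IsRationalClosure ι)
    {G₁ G₂ : Subgroup G} (h : IsDirectProduct G₁ G₂ ⊤) :
    IsDirectProduct (rationalClosureIn (G₁.map ι)) (rationalClosureIn (G₂.map ι)) ⊤ := by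
  have := hι.isMulTorsionFree
  obtain ⟨r₁, -, p₁⟩ :=
    isRational_rationalClosureIn_and_exists_pow_mem hι.nilpotent (G₁.map ι)
  obtain ⟨r₂, -, p₂⟩ :=
    isRational_rationalClosureIn_and_exists_pow_mem hι.nilpotent (G₂.map ι)
  have i₁ := (isRational_rationalClosureIn_and_exists_pow_mem hι.nilpotent (G₁.map ι)).2.1
  have i₂ := (isRational_rationalClosureIn_and_exists_pow_mem hι.nilpotent (G₂.map ι)).2.1
  have hcomm : ∀ a ∈ rationalClosureIn (G₁.map ι), ∀ b ∈ rationalClosureIn (G₂.map ι),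
      a * b = b * a := by
    intro a ha b hb
    obtain ⟨n, hn, g, hg, hga⟩ := p₁ a ha
    obtain ⟨m, hm, g', hg', hgb⟩ := p₂ b hb
    refine mul_comm_of_pow_mul_comm hn.ne' (mul_comm_of_pow_mul_comm hm.ne' ?_).symm
    rw [← hga, ← hgb, ← map_mul, ← map_mul, h.commute g hg g' hg']
  refine ⟨hcomm, ?_, ?_⟩
  · rw [eq_bot_iff]
    rintro x ⟨h1, h2⟩
    obtain ⟨n, hn, hx⟩ := p₁ x h1
    obtain ⟨m, hm, hx'⟩ := p₂ x h2
    have h3 : x ^ (n * m) ∈ G₁.map ι ⊓ G₂.map ι :=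
      Subgroup.mem_inf.mpr ⟨by rw [pow_mul]; exact pow_mem hx _,
        by rw [mul_comm, pow_mul]; exact pow_mem hx' _⟩
    rw [← Subgroup.map_inf _ _ _ hι.injective, h.disjoint, Subgroup.map_bot,
      Subgroup.mem_bot] at h3
    exact Subgroup.mem_bot.mpr
      ((pow_eq_one_iff_left (Nat.mul_pos hn hm).ne').mp h3)
  · rw [eq_top_iff]
    intro x _
    obtain ⟨n, hn, g, hg⟩ := hι.exists_pow_mem x
    obtain ⟨α, β, hp⟩ := h.exists_projections
    obtain ⟨a, ha, -⟩ := hι.existsUnique_root (ι (α g)) n hn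
    obtain ⟨b, hb, -⟩ := hι.existsUnique_root (ι (β g)) n hn
    have hA : a ∈ rationalClosureIn (G₁.map ι) :=
      r₁ a n hn (i₁ ⟨α g, hp.left_mem g, ha.symm⟩)
    have hB : b ∈ rationalClosureIn (G₂.map ι) :=
      r₂ b n hn (i₂ ⟨β g, hp.right_mem g, hb.symm⟩)
    have hab : x = a * b := by
      refine pow_left_injective hn.ne' ?_
      change x ^ n = (a * b) ^ n
      have hc : Commute a b := hcomm a hA b hB
      rw [hc.mul_pow, ha, hb, ← map_mul, hp.mul_eq, hg]
    rw [hab]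
    exact mul_mem (Subgroup.mem_sup_left hA) (Subgroup.mem_sup_right hB)

/-- If `x` is a central element of an indecomposable rational subgroup `S` and `x` has no power in
the kernel of a homomorphism `F` from `G` to `ℤ`, then `S` is central. -/
theorem RationallyIndecomposable.le_center_of_hom_int {ι : G →* H} (hι : IsRationalClosure ι)
    (F : G →* Multiplicative ℤ) {S : Subgroup H} (hS : IsRationalSubgroup S)
    (hind : RationallyIndecomposable S) {x : H} (hxS : x ∈ S) (hxZ : x ∈ Subgroup.center H)
    (hxD : x ∉ rationalClosureIn (F.ker.map ι)) : S ≤ Subgroup.center H := by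
  have := hι.isMulTorsionFree
  obtain ⟨rD, iD, -⟩ :=
    isRational_rationalClosureIn_and_exists_pow_mem hι.nilpotent (F.ker.map ι)
  obtain ⟨rC, iC, pC⟩ :=
    isRational_rationalClosureIn_and_exists_pow_mem hι.nilpotent (Subgroup.zpowers x)
  have hxC : x ∈ rationalClosureIn (Subgroup.zpowers x) := iC (Subgroup.mem_zpowers x)
  have hCS : rationalClosureIn (Subgroup.zpowers x) ≤ S :=
    rationalClosureIn_le hS (by rwa [Subgroup.zpowers_le])
  have hCZ : rationalClosureIn (Subgroup.zpowers x) ≤ Subgroup.center H :=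
    rationalClosureIn_le isRationalSubgroup_center (by rwa [Subgroup.zpowers_le])
  set D := rationalClosureIn (F.ker.map ι) with hD
  set C := rationalClosureIn (Subgroup.zpowers x) with hC
  -- `D` plays the role of a hyperplane missing `x`, and `C` that of the central line through `x`,
  -- so `C` is a complement to `S ⊓ D` in `S`.
  have hdp : IsDirectProduct C (S ⊓ D) S := by
    refine ⟨fun a ha b _ => (Subgroup.mem_center_iff.mp (hCZ ha) b).symm, ?_, ?_⟩
    · rw [eq_bot_iff]
      rintro y ⟨hyC, -, hyD⟩
      obtain ⟨n, hn, k, hk⟩ := pC y hyC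
      replace hk : x ^ k = y ^ n := hk
      rcases eq_or_ne k 0 with rfl | hk0
      · rw [zpow_zero] at hk
        exact Subgroup.mem_bot.mpr ((pow_eq_one_iff_left hn.ne').mp hk.symm)
      · exact absurd (rD.mem_of_zpow_mem hk0 (hk ▸ pow_mem hyD n)) hxD
    · refine le_antisymm (sup_le hCS inf_le_left) fun y hy => ?_
      obtain ⟨n, hn, gy, hgy⟩ := hι.exists_pow_mem y
      obtain ⟨m, hm, gx, hgx⟩ := hι.exists_pow_mem x
      set a := (F gy).toAdd with ha
      set b := (F gx).toAdd with hb
      have hb0 : b ≠ 0 := by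
        intro h0
        have hk : gx ∈ F.ker := MonoidHom.mem_ker.mpr (Multiplicative.toAdd.injective h0)
        exact hxD (rD x m hm (hgx ▸ iD (Subgroup.mem_map_of_mem ι hk)))
      have hker : gy ^ b * (gx ^ a)⁻¹ ∈ F.ker := by
        rw [MonoidHom.mem_ker]
        apply Multiplicative.toAdd.injective
        rw [map_mul, map_inv, map_zpow, map_zpow, toAdd_mul, toAdd_inv, toAdd_zpow, toAdd_zpow,
          ← ha, ← hb, toAdd_one, smul_eq_mul, smul_eq_mul]
        ring
      have hpow : y ^ (n * b) * (x ^ (m * a))⁻¹ ∈ D := by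
        have := iD (Subgroup.mem_map_of_mem ι hker)
        rwa [map_mul, map_inv, map_zpow, map_zpow, hgy, hgx, ← zpow_natCast, ← zpow_natCast,
          ← zpow_mul, ← zpow_mul] at this
      have hN : (n : ℤ) * b ≠ 0 := mul_ne_zero (by exact_mod_cast hn.ne') hb0
      -- `w` is the `C`-component of `y`: it is chosen so that the power of `y * w⁻¹` with exponent
      -- `n * b` is the element of `D` found in `hpow`.
      obtain ⟨w, hw⟩ : ∃ w : H, w ^ ((n : ℤ) * b) = x ^ (m * a) := by
        obtain ⟨w, hw, -⟩ := hι.existsUnique_root (x ^ (m * a)) _ (Int.natAbs_pos.mpr hN)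
        rcases Int.natAbs_eq ((n : ℤ) * b) with h | h
        · exact ⟨w, by rw [h, zpow_natCast, hw]⟩
        · exact ⟨w⁻¹, by rw [h, zpow_neg, inv_zpow, inv_inv, zpow_natCast, hw]⟩
      have hwC : w ∈ C := rC.mem_of_zpow_mem hN (by rw [hw]; exact zpow_mem hxC _)
      have hcomm : Commute y w⁻¹ := Subgroup.mem_center_iff.mp (inv_mem (hCZ hwC)) y
      have hyw : y * w⁻¹ ∈ D := rD.mem_of_zpow_mem hN (by
        rw [hcomm.mul_zpow, inv_zpow, hw]; exact hpow)
      have hy' : y = y * w⁻¹ * w := by group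
      rw [hy']
      exact mul_mem (Subgroup.mem_sup_right (Subgroup.mem_inf.mpr
        ⟨mul_mem hy (inv_mem (hCS hwC)), hyw⟩)) (Subgroup.mem_sup_left hwC)
  rcases hind _ _ rC (isRationalSubgroup_inf hS rD) hdp with h | h
  · rw [h, Subgroup.mem_bot] at hxC
    exact absurd (hxC ▸ one_mem _) hxD
  · rw [← hdp.sup_eq, h, sup_bot_eq]
    exact hCZ

/-- If `G` has a nontrivial direct factor that is central in the rational closure, then one of the
indecomposable factors of the rational closure is central. -/
theorem IsRationalClosure.exists_le_center [Group.FG G] {ι : G →* H} (hι : IsRationalClosure ι)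
    {I : Type*} [Fintype I] {S : I → Subgroup H} (hSdec : IsDirectProductFamily S ⊤)
    (hSrat : ∀ i, IsRationalSubgroup (S i)) (hSind : ∀ i, RationallyIndecomposable (S i))
    {G₁ G₂ : Subgroup G} (hG : IsDirectProduct G₁ G₂ ⊤) (hG₁ : G₁ ≠ ⊥)
    (hZ : G₁.map ι ≤ Subgroup.center H) : ∃ i, S i ≤ Subgroup.center H := by
  have := hι.isMulTorsionFree
  have : IsMulTorsionFree G :=
    ⟨fun n hn x y hxy => hι.injective (pow_left_injective hn (by
      change ι x ^ n = ι y ^ n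
      rw [← map_pow, ← map_pow]; exact congrArg ι hxy))⟩
  obtain ⟨α, β, hp⟩ := hG.exists_projections
  let p : G →* G₁ := α.codRestrict G₁ hp.left_mem
  have hp1 : ∀ g : G₁, p g = g := fun g => Subtype.ext (hp.left_apply g g.2)
  have : Group.FG G₁ := Group.fg_of_surjective (f := p) fun g => ⟨g, hp1 g⟩
  have : Nontrivial G₁ := (Subgroup.nontrivial_iff_ne_bot _).mpr hG₁
  obtain ⟨f, g, hfg⟩ := exists_hom_int_ne_one_of_mul_comm G₁ fun x y =>
    Subtype.ext (hι.injective (by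
    rw [Subgroup.coe_mul, Subgroup.coe_mul, map_mul, map_mul]
    exact Subgroup.mem_center_iff.mp (hZ (Subgroup.mem_map_of_mem ι y.2)) _))
  have hgD : ι g ∉ rationalClosureIn ((f.comp p).ker.map ι) := by
    intro hmem
    obtain ⟨n, hn, k, hk, hkg⟩ :=
      (isRational_rationalClosureIn_and_exists_pow_mem hι.nilpotent _).2.2 _ hmem
    rw [← map_pow] at hkg
    have h1 : f (p ((g : G) ^ n)) = 1 := by
      rw [← hι.injective hkg]; exact hk
    rw [map_pow, map_pow, hp1] at h1
    exact hfg ((pow_eq_one_iff_left hn.ne').mp h1)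
  obtain ⟨i, x, hxS, hxZ, hxD⟩ :=
    hSdec.exists_central_component (hZ (Subgroup.mem_map_of_mem ι g.2)) hgD
  exact ⟨i, (hSind i).le_center_of_hom_int hι (f.comp p) (hSrat i) hxS hxZ hxD⟩

/-- With `j` the cardinality of `J`, a bijection from the first `j` indices to `J` extends to a
permutation. -/
theorem exists_perm_lt_iff_mem {m : ℕ} (J : Set (Fin m)) (hJ : J.Nonempty) (hJ' : Jᶜ.Nonempty) :
    ∃ (σ : Equiv.Perm (Fin m)) (j : ℕ), 0 < j ∧ j < m ∧ ∀ i, σ i ∈ J ↔ (i : ℕ) < j := by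
  classical
  have hcard : Fintype.card J ≤ m := by simpa using set_fintype_card_le_univ J
  have hlt : Fintype.card J < m := by
    refine lt_of_le_of_ne hcard fun h => ?_
    obtain ⟨i, hi⟩ := hJ'
    have : J = Set.univ := by rw [← set_fintype_card_eq_univ_iff, h, Fintype.card_fin]
    exact hi (this ▸ Set.mem_univ i)
  have hpos : 0 < Fintype.card J := by
    obtain ⟨i, hi⟩ := hJ
    exact Fintype.card_pos_iff.mpr ⟨⟨i, hi⟩⟩
  have hc : Fintype.card {i : Fin m // (i : ℕ) < Fintype.card J} = Fintype.card J := by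
    have e : {i : Fin m // (i : ℕ) < Fintype.card J} ≃ Fin (Fintype.card J) :=
      { toFun := fun i => ⟨i.1, i.2⟩
        invFun := fun i => ⟨⟨i, i.2.trans_le hcard⟩, i.2⟩
        left_inv := fun i => rfl
        right_inv := fun i => rfl }
    rw [Fintype.card_congr e, Fintype.card_fin]
  let e : {i : Fin m // (i : ℕ) < Fintype.card J} ≃ {i // i ∈ J} := Fintype.equivOfCardEq hc
  refine ⟨e.extendSubtype, Fintype.card J, hpos, hlt, fun i => ⟨fun h => ?_, fun h => ?_⟩⟩
  · by_contra hi
    exact e.extendSubtype_not_mem i hi h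
  · exact e.extendSubtype_mem i h

/-- The indecomposable factors of the rational closure are distributed among the two factors
of `G`. -/
theorem IsRationalClosure.exists_partition [Group.FG G] (hnil : Group.IsNilpotent G) {ι : G →* H}
    (hι : IsRationalClosure ι) {I : Type*} [Fintype I] {S : I → Subgroup H}
    (hSdec : IsDirectProductFamily S ⊤)
    (hSrat : ∀ i, IsRationalSubgroup (S i)) (hSind : ∀ i, RationallyIndecomposable (S i))
    {G₁ G₂ : Subgroup G} (hG : IsDirectProduct G₁ G₂ ⊤) (hG₁ : G₁ ≠ ⊥) (hG₂ : G₂ ≠ ⊥) :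
    ∃ J : Set I, J.Nonempty ∧ Jᶜ.Nonempty ∧
      (∀ i ∈ J, S i ≤ rationalClosureIn (G₁.map ι) ⊔ Subgroup.center H) ∧
      (∀ i ∈ Jᶜ, S i ≤ rationalClosureIn (G₂.map ι) ⊔ Subgroup.center H) := by
  have := hι.isMulTorsionFree
  have hd : ∀ (h : H) (n : ℕ), 0 < n → ∃ k, k ^ n = h :=
    fun h n hn => (hι.existsUnique_root h n hn).exists
  have hAB := hι.isDirectProduct hG
  obtain ⟨r₁, i₁, -⟩ :=
    isRational_rationalClosureIn_and_exists_pow_mem hι.nilpotent (G₁.map ι)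
  obtain ⟨r₂, i₂, -⟩ :=
    isRational_rationalClosureIn_and_exists_pow_mem hι.nilpotent (G₂.map ι)
  set A := rationalClosureIn (G₁.map ι)
  set B := rationalClosureIn (G₂.map ι)
  have hAne : A ≠ ⊥ := fun h => hG₁ (by
    rw [← Subgroup.map_eq_bot_iff_of_injective _ hι.injective]; exact le_bot_iff.mp (h ▸ i₁))
  have hBne : B ≠ ⊥ := fun h => hG₂ (by
    rw [← Subgroup.map_eq_bot_iff_of_injective _ hι.injective]; exact le_bot_iff.mp (h ▸ i₂))
  have hor : ∀ i, S i ≤ A ⊔ Subgroup.center H ∨ S i ≤ B ⊔ Subgroup.center H := fun i =>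
    (hSind i).le_sup_center_or_le_sup_center hd (hι.rationalChainCondition hnil) hAB
      (S' := ⨆ j ∈ ({i} : Set I)ᶜ, S j)
      (by simpa only [Set.mem_singleton_iff, iSup_iSup_eq_left] using
        hSdec.isDirectProduct_biSup {i}) (hSrat i)
  have hcentral : ∀ {A B : Subgroup H}, IsDirectProduct A B ⊤ →
      (∀ i, S i ≤ B ⊔ Subgroup.center H) → A ≤ Subgroup.center H := by
    intro A B h hle
    have htop : (⊤ : Subgroup H) ≤ B ⊔ Subgroup.center H := by
      rw [← hSdec.iSup_eq]; exact iSup_le hle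
    exact fun a ha => h.sup_center_inf_sup_center_le
      (Subgroup.mem_inf.mpr ⟨Subgroup.mem_sup_left ha, htop (Subgroup.mem_top a)⟩)
  set J : Set I := {i | S i ≤ A ⊔ Subgroup.center H} with hJdef
  have hJc : ∀ i ∈ Jᶜ, S i ≤ B ⊔ Subgroup.center H := fun i hi => (hor i).resolve_left hi
  have hJ : J.Nonempty := by
    by_contra hempty
    rw [Set.not_nonempty_iff_eq_empty] at hempty
    have hA : A ≤ Subgroup.center H := hcentral hAB fun i => hJc i (by rw [hempty]; exact id)
    obtain ⟨i, hi⟩ := hι.exists_le_center hSdec hSrat hSind hG hG₁ (i₁.trans hA)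
    have : i ∈ J := hi.trans le_sup_right
    rw [hempty] at this
    exact this
  by_cases hJ' : Jᶜ.Nonempty
  · exact ⟨J, hJ, hJ', fun i hi => hi, hJc⟩
  rw [Set.not_nonempty_iff_eq_empty, Set.compl_empty_iff] at hJ'
  have hall : ∀ i, S i ≤ A ⊔ Subgroup.center H := fun i => by
    have : i ∈ J := hJ' ▸ Set.mem_univ i
    exact this
  have hB : B ≤ Subgroup.center H := hcentral hAB.symm hall
  obtain ⟨i, hi⟩ := hι.exists_le_center hSdec hSrat hSind hG.symm hG₂ (i₂.trans hB)
  -- The central factor `S i` is moved to the second side. It cannot be the only factor: otherwise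
  -- `A × B` would decompose `S i = H`.
  refine ⟨{i}ᶜ, ?_, ⟨i, by simp⟩, fun j _ => hall j, fun j hj => ?_⟩
  · by_contra hempty
    rw [Set.not_nonempty_iff_eq_empty, Set.compl_empty_iff] at hempty
    have htop : S i = ⊤ := by
      rw [eq_top_iff, ← hSdec.iSup_eq]
      refine iSup_le fun j => ?_
      have : j ∈ ({i} : Set I) := hempty ▸ Set.mem_univ j
      rw [Set.mem_singleton_iff.mp this]
    rcases hSind i A B r₁ r₂ (htop ▸ hAB) with h | h
    · exact hAne h
    · exact hBne h
  · rw [compl_compl, Set.mem_singleton_iff] at hj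
    subst hj
    exact hi.trans le_sup_right

end Main

theorem mainTheorem8 {G H : Type*} [Group G] [Group H]
    (hfg : Group.FG G) (hnil : Group.IsNilpotent G) (htf : GroupTorsionFree G)
    (ι : G →* H) (hι : IsRationalClosure ι)
    (m : ℕ) (S : Fin m → Subgroup H)
    (hSdec : IsDirectProductFamily S ⊤)
    (hSne : ∀ i, S i ≠ ⊥)
    (hSrat : ∀ i, IsRationalSubgroup (S i))
    (hSind : ∀ i, RationallyIndecomposable (S i))
    (G₁ G₂ : Subgroup G) (hGdec : IsDirectProduct G₁ G₂ ⊤)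
    (hG₁ : G₁ ≠ ⊥) (hG₂ : G₂ ≠ ⊥) :
    ∃ (σ : Equiv.Perm (Fin m)) (j : ℕ), 0 < j ∧ j < m ∧
      ∃ R₁ R₂ : Subgroup H,
        R₁ = ⨆ i : {i : Fin m // (i : ℕ) < j}, S (σ i) ∧
        R₂ = ⨆ i : {i : Fin m // j ≤ (i : ℕ)}, S (σ i) ∧
        IsDirectProduct R₁ R₂ ⊤ ∧
        DecompositionMatches ι R₁ R₂ G₁ G₂ := by
  obtain ⟨J, hJ, hJ', h₁, h₂⟩ := hι.exists_partition hnil hSdec hSrat hSind hGdec hG₁ hG₂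
  obtain ⟨σ, j, hj, hjm, hσ⟩ := exists_perm_lt_iff_mem J hJ hJ'
  have e₁ : ⨆ i ∈ J, S i = ⨆ i : {i : Fin m // (i : ℕ) < j}, S (σ i) := by
    refine le_antisymm (iSup₂_le fun i hi => ?_)
      (iSup_le fun i => le_biSup S ((hσ i.1).mpr i.2))
    have hlt : ((σ.symm i : Fin m) : ℕ) < j := (hσ _).mp (by rwa [σ.apply_symm_apply])
    have := le_iSup (fun i : {i : Fin m // (i : ℕ) < j} => S (σ i)) ⟨σ.symm i, hlt⟩
    simpa only [σ.apply_symm_apply] using this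
  have e₂ : ⨆ i ∈ Jᶜ, S i = ⨆ i : {i : Fin m // j ≤ (i : ℕ)}, S (σ i) := by
    refine le_antisymm (iSup₂_le fun i hi => ?_)
      (iSup_le fun i => le_biSup S
        (show σ i.1 ∈ Jᶜ from fun h => absurd ((hσ i.1).mp h) i.2.not_gt))
    have hle : j ≤ ((σ.symm i : Fin m) : ℕ) := not_lt.mp fun h =>
      hi (by simpa only [σ.apply_symm_apply] using (hσ (σ.symm i)).mpr h)
    have := le_iSup (fun i : {i : Fin m // j ≤ (i : ℕ)} => S (σ i)) ⟨σ.symm i, hle⟩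
    simpa only [σ.apply_symm_apply] using this
  have hR := hSdec.isDirectProduct_biSup J
  have hAB := hι.isDirectProduct hGdec
  refine ⟨σ, j, hj, hjm, _, _, e₁, e₂, hR, ?_, ?_⟩
  · rw [← Subgroup.mul_normal, ← Subgroup.mul_normal,
      hAB.sup_center_eq hR (iSup₂_le h₁) (iSup₂_le h₂)]
  · rw [← Subgroup.mul_normal, ← Subgroup.mul_normal,
      hAB.symm.sup_center_eq hR.symm (iSup₂_le h₂) (iSup₂_le h₁)]
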